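/- **Setting.** Let $\gamma_+,\gamma_->0$ be constants and let $\gamma_0(x)=\gamma_+$ if $x_3>0$ and $\gamma_0(x)=\gamma_-$ if $x_3<0$, for $x\in\mathbb R^3$. Let $D\subset\mathbb R^3$ be a bounded open set with $C^2$ boundary and $\overline D\subset\{x_3<0\}$. Let $h$ be a real symmetric $3\times3$-matrix valued function on $D$ with essentially bounded entries, and let $\gamma=\gamma_0I_3$ in $\mathbb R^3\setminus D$ and $\gamma=\gamma_0I_3+h$ in $D$. Assume that there is a constant $C>0$ with $\gamma(x)\xi\cdot\xi\ge C|\xi|^2$ for all $\xi\in\mathbb R^3$ and a.e. $x\in D$. Let $0<T<\infty$ and $f\in L^2(\mathbb R^3)$. Let $u$ be the weak solution of $$(\partial_t^2-\nabla\cdot\gamma\nabla)u=0\ \text{ in }\mathbb R^3\times(0,T),\qquad u(x,0)=0,\quad \partial_tu(x,0)=f(x)\ \text{ on }\mathbb R^3,$$ that is, $u\in L^2(0,T;H^1(\mathbb R^3))$, $\partial_tu\in L^2(0,T;L^2(\mathbb R^3))$, $u(0)=0$, and for every $\varphi\in H^1(\mathbb R^3)$ one has $\frac{d}{dt}\int_{\mathbb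 R^3}\partial_tu\,\varphi\,dx+\int_{\mathbb R^3}\gamma\nabla u\cdot\nabla\varphi\,dx=0$ in the sense of distributions on $(0,T)$, with $\partial_tu(0)=f$. For $\tau>0$ put $$w(x,\tau)=\int_0^Te^{-\tau t}u(x,t)\,dt ,$$ let $v=v(\cdot,\tau)\in H^1(\mathbb R^3)$ be the weak solution of $(\nabla\cdot\gamma_0\nabla-\tau^2)v+f=0$ in $\mathbb R^3$, and let $$I_f(\tau,T)=\int_{\mathbb R^3}f\,(w-v)\,dx .$$ **Lemma 1.1.** As $\tau\to\infty$, $$I_f(\tau,T)\ \ge\ \int_{\mathbb R^3}(\gamma_0I_3-\gamma)\nabla v\cdot\nabla v\,dx+O(\tau^{-1}e^{-\tau T})$$ and $$I_f(\tau,T)\ \le\ \int_{\mathbb R^3}\gamma_0(\gamma_0I_3-\gamma)\gamma^{-1/2}\nabla v\cdot\gamma^{-1/2}\nabla v\,dx+O(\tau^{-1}e^{-\tau T}).$$ -/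

import Mathlib

open MeasureTheory Set Filter Topology
open scoped ContDiff Matrix MatrixOrder ENNReal

noncomputable section

namespace LayeredWave

/-- Euclidean space `ℝ³`; the coordinates of `x` are `x 0`, `x 1`, `x 2`. -/
abbrev E3 : Type := EuclideanSpace ℝ (Fin 3)

/-- The space `L²(ℝ³)` of real-valued functions. -/
abbrev L2 : Type := Lp ℝ 2 (volume : Measure E3)

/-- The space `L²(ℝ³)³` of vector fields. -/
abbrev L2Vec : Type := Lp E3 2 (volume : Measure E3)

/-- `g` is the weak gradient of `u` on `ℝ³`: for every test function `φ ∈ C_c^∞(ℝ³)`,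
`∫ u ∇φ dx = - ∫ φ g dx`. -/
def IsWeakGradient (u : E3 → ℝ) (g : E3 → E3) : Prop :=
  ∀ φ : E3 → ℝ, ContDiff ℝ ∞ φ → HasCompactSupport φ →
    ∫ x, u x • gradient φ x = -∫ x, φ x • g x

theorem integrable_smul_gradient (u : L2) {φ : E3 → ℝ} (hφ : ContDiff ℝ ∞ φ)
    (hc : HasCompactSupport φ) : Integrable (fun x => u x • gradient φ x) := by
  have hcont : Continuous (gradient φ) := by
    unfold gradient
    exact (InnerProductSpace.toDual ℝ E3).symm.continuous.comp
      (hφ.continuous_fderiv (by simp))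
  have hsupp : HasCompactSupport (gradient φ) :=
    (hc.fderiv ℝ).comp_left (g := (InnerProductSpace.toDual ℝ E3).symm) (by simp)
  have hm : MemLp (gradient φ) 2 := hcont.memLp_of_hasCompactSupport hsupp
  exact memLp_one_iff_integrable.1 (hm.smul (Lp.memLp u))

theorem integrable_testFunction_smul (g : L2Vec) {φ : E3 → ℝ} (hφ : ContDiff ℝ ∞ φ)
    (hc : HasCompactSupport φ) : Integrable (fun x => φ x • g x) := by
  have hm : MemLp φ 2 := hφ.continuous.memLp_of_hasCompactSupport hc
  exact memLp_one_iff_integrable.1 ((Lp.memLp g).smul hm)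

/-- The Sobolev space `H¹(ℝ³)`, realized as the space of pairs `(u, ∇u)` with `u ∈ L²(ℝ³)` whose
weak gradient `∇u` is in `L²(ℝ³)³`. The norm inherited from the ambient Hilbert space is
`‖u‖_{H¹}² = ‖u‖² + ‖∇u‖²`. -/
def H1 : Submodule ℝ (WithLp 2 (L2 × L2Vec)) where
  carrier := {p | IsWeakGradient p.fst p.snd}
  zero_mem' := by
    intro φ hφ hc
    have h1 : ∫ x, ((0 : L2) : E3 → ℝ) x • gradient φ x = 0 :=
      integral_eq_zero_of_ae (by
        filter_upwards [Lp.coeFn_zero ℝ 2 (volume : Measure E3)] with x hx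
        rw [hx, Pi.zero_apply, zero_smul, Pi.zero_apply])
    have h2 : ∫ x, φ x • ((0 : L2Vec) : E3 → E3) x = 0 :=
      integral_eq_zero_of_ae (by
        filter_upwards [Lp.coeFn_zero E3 2 (volume : Measure E3)] with x hx
        rw [hx, Pi.zero_apply, smul_zero])
    change ∫ x, ((0 : L2) : E3 → ℝ) x • gradient φ x = -∫ x, φ x • ((0 : L2Vec) : E3 → E3) x
    rw [h1, h2, neg_zero]
  add_mem' := by
    intro p q hp hq φ hφ hc
    have h1 : ∫ x, ((p.fst + q.fst : L2) : E3 → ℝ) x • gradient φ x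
        = ∫ x, (p.fst x • gradient φ x + q.fst x • gradient φ x) :=
      integral_congr_ae (by
        filter_upwards [Lp.coeFn_add p.fst q.fst] with x hx
        rw [hx, Pi.add_apply, add_smul])
    have h2 : ∫ x, φ x • ((p.snd + q.snd : L2Vec) : E3 → E3) x
        = ∫ x, (φ x • p.snd x + φ x • q.snd x) :=
      integral_congr_ae (by
        filter_upwards [Lp.coeFn_add p.snd q.snd] with x hx
        rw [hx, Pi.add_apply, smul_add])
    change ∫ x, ((p.fst + q.fst : L2) : E3 → ℝ) x • gradient φ x
      = -∫ x, φ x • ((p.snd + q.snd : L2Vec) : E3 → E3) x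
    rw [h1, h2, integral_add (integrable_smul_gradient _ hφ hc)
        (integrable_smul_gradient _ hφ hc),
      integral_add (integrable_testFunction_smul _ hφ hc)
        (integrable_testFunction_smul _ hφ hc), hp φ hφ hc, hq φ hφ hc, neg_add]
  smul_mem' := by
    intro c p hp φ hφ hc
    have h1 : ∫ x, ((c • p.fst : L2) : E3 → ℝ) x • gradient φ x
        = ∫ x, c • (p.fst x • gradient φ x) :=
      integral_congr_ae (by
        filter_upwards [Lp.coeFn_smul c p.fst] with x hx
        rw [hx, Pi.smul_apply, smul_assoc])
    have h2 : ∫ x, φ x • ((c • p.snd : L2Vec) : E3 → E3) x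
        = ∫ x, c • (φ x • p.snd x) :=
      integral_congr_ae (by
        filter_upwards [Lp.coeFn_smul c p.snd] with x hx
        rw [hx, Pi.smul_apply, smul_comm])
    change ∫ x, ((c • p.fst : L2) : E3 → ℝ) x • gradient φ x
      = -∫ x, φ x • ((c • p.snd : L2Vec) : E3 → E3) x
    rw [h1, h2, integral_smul, integral_smul, hp φ hφ hc, smul_neg]

/-- The `L²` function underlying an element of `H¹(ℝ³)`. -/
def toL2 (u : H1) : L2 := (u : WithLp 2 (L2 × L2Vec)).fst

/-- The weak gradient of an element of `H¹(ℝ³)`. -/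
def weakGrad (u : H1) : L2Vec := (u : WithLp 2 (L2 × L2Vec)).snd

/-- The background coefficient: `γ₊` in the upper half-space, `γ₋` in the lower one. The value on
the null set `x₃ = 0` is immaterial. -/
def background (γp γm : ℝ) (x : E3) : ℝ := if 0 < x 2 then γp else γm

/-- The coefficient with the obstacle: `γ₀ I₃` outside `D`, and `γ₀ I₃ + h` in `D`. -/
def conductivity (γp γm : ℝ) (D : Set E3) (h : E3 → Matrix (Fin 3) (Fin 3) ℝ) (x : E3) :
    Matrix (Fin 3) (Fin 3) ℝ :=
  background γp γm x • (1 : Matrix (Fin 3) (Fin 3) ℝ) + D.indicator h x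

/-- `D` has a `C²` boundary: near each of its boundary points, `D` is the sublevel set `{ψ < 0}` of
a `C²` function `ψ` without critical points. -/
def HasC2Boundary (D : Set E3) : Prop :=
  ∀ p ∈ frontier D, ∃ (U : Set E3) (ψ : E3 → ℝ), IsOpen U ∧ p ∈ U ∧ ContDiffOn ℝ 2 ψ U ∧
    (∀ x ∈ U, fderiv ℝ ψ x ≠ 0) ∧ D ∩ U = {x ∈ U | ψ x < 0}

/-- The form `∫ A ∇u · ∇φ dx` of a matrix-valued coefficient `A`. -/
def energyForm (A : E3 → Matrix (Fin 3) (Fin 3) ℝ) (u φ : H1) : ℝ :=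
  ∫ x, (A x *ᵥ (weakGrad u x).ofLp) ⬝ᵥ (weakGrad φ x).ofLp

/-- `u` is a weak solution of `(∂ₜ² - ∇·A∇)u = 0` in `ℝ³ × (0,T)`, `u(·,0) = 0`,
`∂ₜu(·,0) = f`, in the class `u ∈ L²(0,T;H¹(ℝ³))`, `∂ₜu ∈ L²(0,T;L²(ℝ³))`. Time derivatives are
taken in the distribution sense. The test functions `ψ` in time are smooth and vanish near `t = T`,
but not necessarily near `t = 0`, so that the initial conditions are part of the identities:
the first one says that `p = ∂ₜu` and `u(·,0) = 0`, the second one that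
`d/dt (∂ₜu, φ) + ∫ A∇u·∇φ dx = 0` for all `φ ∈ H¹(ℝ³)` and `∂ₜu(·,0) = f`. -/
def IsWeakWaveSolution (A : E3 → Matrix (Fin 3) (Fin 3) ℝ) (T : ℝ) (f : L2) (u : ℝ → H1) :
    Prop :=
  MemLp u 2 (volume.restrict (Ioo 0 T)) ∧
  ∃ p : ℝ → L2, MemLp p 2 (volume.restrict (Ioo 0 T)) ∧
    (∀ ψ : ℝ → ℝ, ContDiff ℝ ∞ ψ → tsupport ψ ⊆ Iio T →
      ∫ t in Ioo 0 T, deriv ψ t • toL2 (u t) = -∫ t in Ioo 0 T, ψ t • p t) ∧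
    (∀ φ : H1, ∀ ψ : ℝ → ℝ, ContDiff ℝ ∞ ψ → tsupport ψ ⊆ Iio T →
      ∫ t in Ioo 0 T, (-(deriv ψ t * ∫ x, p t x * toL2 φ x) + ψ t * energyForm A (u t) φ)
        = ψ 0 * ∫ x, f x * toL2 φ x)

/-- `v ∈ H¹(ℝ³)` is the weak solution of `(∇·a∇ - τ²)v + f = 0` in `ℝ³`, for a scalar
coefficient `a`. -/
def IsWeakEllipticSolution (a : E3 → ℝ) (τ : ℝ) (f : L2) (v : H1) : Prop :=
  ∀ φ : H1, energyForm (fun x => a x • (1 : Matrix (Fin 3) (Fin 3) ℝ)) v φ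
    + τ ^ 2 * ∫ x, toL2 v x * toL2 φ x = ∫ x, f x * toL2 φ x

/-- The truncated Laplace transform `w(·,τ) = ∫₀ᵀ e^{-τt} u(·,t) dt`, as an `L²(ℝ³)`-valued
Bochner integral. -/
def truncatedLaplace (T τ : ℝ) (u : ℝ → H1) : L2 :=
  ∫ t in (0 : ℝ)..T, Real.exp (-τ * t) • toL2 (u t)

/-- The indicator function `I_f(τ,T) = ∫ f (w - v) dx`. -/
def indicatorFunction (T τ : ℝ) (f : L2) (u : ℝ → H1) (v : H1) : ℝ :=
  ∫ x, f x * (truncatedLaplace T τ u x - toL2 v x)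

/-- The matrix `M^{-1/2}` of a symmetric positive definite matrix `M`, from the functional
calculus of symmetric matrices. -/
def invSqrt (M : Matrix (Fin 3) (Fin 3) ℝ) : Matrix (Fin 3) (Fin 3) ℝ := M ^ (-(1 / 2) : ℝ)

end LayeredWave

end

/-!
Write `ε = e^{-τT}`, let `E` and `E₀` be the energy forms of `γ` and `γ₀ I₃`, and let
`R = w - v`. Integrating the wave equation against `e^{-τt} φ` shows that `w ∈ H¹(ℝ³)` satisfies
`E(w, φ) + τ² (w, φ) = (f, φ) - ε F(φ)`, where formally `F = ∂ₜu(T) + τ u(T)`. Traces at time `T`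
are avoided by testing with `e^{-τt} - e^{-τT}`, which vanishes at `T`: this gives `F` in the form
`F(φ) = (f, φ) - E(∫₀ᵀ u, φ) + τ (∫₀ᵀ ∂ₜu, φ)` (`residual`, `exists_truncatedLaplace_eq`), visibly
a functional bounded by `K (‖∇φ‖ + τ ‖φ‖)` for `τ ≥ 1`.

Testing the equations of `w` and `v` with `w` and `v` gives the two identities
* `(f, R) = E₀(v, v) - E(v, v) + (E(R, R) + τ² ‖R‖²) + ε (F(w) - 2 F(v))`,
* `(f, R) = E₀(w, w) - E(w, w) - (E₀(R, R) + τ² ‖R‖²) - ε F(w)`.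

Coercivity bounds `‖∇w‖ + τ ‖w‖` and `‖∇v‖ + τ ‖v‖` by a multiple of `1 / τ`
(`norm_add_le_of_energy_le`), so `F(w)` and `F(v)` are `O(τ⁻¹)`, and the terms with `ε` are the
remainders of the theorem. The first identity is then the lower bound, since `E(R, R) ≥ 0`. For
the upper bound, let `z = γ₀ γ⁻¹ ∇v`. Completing the square,
`E₀(w, w) - E(w, w) - E₀(R, R) ≤ ∫ γ₀ ∇v · z - ∫ γ₀ |∇v|²`, the difference being
`∫ γ(∇w - z) · (∇w - z)`; the right-hand side is the integral with `γ^{-1/2}`, because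
`γ^{-1/2} γ^{-1/2} γ = 1 = γ^{-1/2} γ γ^{-1/2}` (`integral_invSqrt_eq`). The field `z` is obtained
from the Lax–Milgram theorem (`IsBoundedCoeff.exists_op_eq`), which makes the integrability of the
integrand with `γ^{-1/2}` automatic.
-/

namespace LayeredWave

/-! ### Bounded matrix coefficients as operators on `L²(ℝ³)³` -/

/-- The entries of the matrix-valued coefficient `A` are measurable and bounded by `B`, both up to null
sets. -/
structure IsBoundedCoeff (A : E3 → Matrix (Fin 3) (Fin 3) ℝ) (B : ℝ) : Prop where
  aestronglyMeasurable : ∀ i j, AEStronglyMeasurable (fun x => A x i j) volume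
  bound : ∀ᵐ x, ∀ i j, |A x i j| ≤ B

/-- A crude bound of the operator norm by the entries; the constant is immaterial. -/
theorem norm_toLp_mulVec_le {M : Matrix (Fin 3) (Fin 3) ℝ} {B : ℝ} (hM : ∀ i j, |M i j| ≤ B)
    (ξ : E3) : ‖(WithLp.toLp 2 (M *ᵥ ξ.ofLp) : E3)‖ ≤ 9 * B * ‖ξ‖ := by
  have hi : ∀ i, |(M *ᵥ ξ.ofLp) i| ≤ 3 * B * ‖ξ‖ := by
    intro i
    have hj : ∀ j, |M i j * ξ j| ≤ B * ‖ξ‖ := fun j => by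
      rw [abs_mul]
      exact mul_le_mul (hM i j) (PiLp.norm_apply_le ξ j) (abs_nonneg _)
        ((abs_nonneg _).trans (hM i j))
    calc |(M *ᵥ ξ.ofLp) i| ≤ ∑ j, |M i j * ξ j| :=
        Finset.abs_sum_le_sum_abs (fun j => M i j * ξ j) Finset.univ
      _ ≤ ∑ _j : Fin 3, B * ‖ξ‖ := Finset.sum_le_sum fun j _ => hj j
      _ = 3 * B * ‖ξ‖ := by simp; ring
  have h0 : 0 ≤ 3 * B * ‖ξ‖ := (abs_nonneg _).trans (hi 0)
  rw [EuclideanSpace.norm_eq]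
  apply Real.sqrt_le_iff.2 ⟨by linarith, ?_⟩
  calc ∑ i, ‖(M *ᵥ ξ.ofLp) i‖ ^ 2 ≤ ∑ _i : Fin 3, (3 * B * ‖ξ‖) ^ 2 :=
        Finset.sum_le_sum fun i _ => pow_le_pow_left₀ (abs_nonneg _) (hi i) 2
    _ ≤ (9 * B * ‖ξ‖) ^ 2 := by simp; nlinarith

namespace IsBoundedCoeff

variable {A : E3 → Matrix (Fin 3) (Fin 3) ℝ} {B : ℝ}

theorem memLp_mulVec (hA : IsBoundedCoeff A B) (g : L2Vec) :
    MemLp (fun x => (WithLp.toLp 2 (A x *ᵥ (g x).ofLp) : E3)) 2 := by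
  have hm : AEStronglyMeasurable (fun x => (WithLp.toLp 2 (A x *ᵥ (g x).ofLp) : E3)) := by
    have h1 : AEStronglyMeasurable (fun x => A x *ᵥ (g x).ofLp) := by
      apply AEMeasurable.aestronglyMeasurable
      refine aemeasurable_pi_lambda _ fun i => ?_
      change AEMeasurable (fun x => ∑ j, A x i j * g x j) volume
      refine Finset.aemeasurable_fun_sum _ fun j _ => ?_
      refine (hA.aestronglyMeasurable i j).aemeasurable.mul ?_
      exact ((EuclideanSpace.proj (𝕜 := ℝ) j).continuous.comp_aestronglyMeasurable
        (Lp.aestronglyMeasurable g)).aemeasurable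
    exact (PiLp.continuous_toLp 2 (fun _ : Fin 3 => ℝ)).comp_aestronglyMeasurable h1
  refine (Lp.memLp g).of_le_mul (c := 9 * B) hm ?_
  filter_upwards [hA.bound] with x hx using norm_toLp_mulVec_le hx _

/-- Multiplication by a bounded coefficient, as a bounded operator on `L²(ℝ³)³`. -/
noncomputable def op (hA : IsBoundedCoeff A B) : L2Vec →L[ℝ] L2Vec :=
  LinearMap.mkContinuous
    { toFun := fun g => (hA.memLp_mulVec g).toLp _
      map_add' := fun g k => by
        apply Lp.ext
        filter_upwards [(hA.memLp_mulVec (g + k)).coeFn_toLp, (hA.memLp_mulVec g).coeFn_toLp,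
          (hA.memLp_mulVec k).coeFn_toLp, Lp.coeFn_add g k,
          Lp.coeFn_add ((hA.memLp_mulVec g).toLp _) ((hA.memLp_mulVec k).toLp _)]
          with x h1 h2 h3 h4 h5
        rw [h1, h5, Pi.add_apply, h2, h3, h4, Pi.add_apply, WithLp.ofLp_add, Matrix.mulVec_add,
          WithLp.toLp_add]
      map_smul' := fun c g => by
        apply Lp.ext
        filter_upwards [(hA.memLp_mulVec (c • g)).coeFn_toLp, (hA.memLp_mulVec g).coeFn_toLp,
          Lp.coeFn_smul c g, Lp.coeFn_smul c ((hA.memLp_mulVec g).toLp _)]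
          with x h1 h2 h3 h4
        rw [h1, RingHom.id_apply, h4, Pi.smul_apply, h2, h3, Pi.smul_apply, WithLp.ofLp_smul,
          Matrix.mulVec_smul, WithLp.toLp_smul] }
    (9 * B) (fun g => by
      apply Lp.norm_le_mul_norm_of_ae_le_mul
      filter_upwards [(hA.memLp_mulVec g).coeFn_toLp, hA.bound] with x h1 hx
      change ‖((hA.memLp_mulVec g).toLp _ : E3 → E3) x‖ ≤ _
      rw [h1]
      exact norm_toLp_mulVec_le hx _)

theorem coeFn_op (hA : IsBoundedCoeff A B) (g : L2Vec) :
    hA.op g =ᵐ[volume] fun x => WithLp.toLp 2 (A x *ᵥ (g x).ofLp) :=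
  (hA.memLp_mulVec g).coeFn_toLp

theorem ae_inner_op (hA : IsBoundedCoeff A B) (g k : L2Vec) :
    (fun x => inner ℝ (hA.op g x) (k x)) =ᵐ[volume]
      fun x => (A x *ᵥ (g x).ofLp) ⬝ᵥ (k x).ofLp := by
  filter_upwards [hA.coeFn_op g] with x hx
  rw [hx, EuclideanSpace.inner_eq_star_dotProduct, star_trivial, dotProduct_comm]

theorem integrable_form (hA : IsBoundedCoeff A B) (g k : L2Vec) :
    Integrable fun x => (A x *ᵥ (g x).ofLp) ⬝ᵥ (k x).ofLp :=
  (L2.integrable_inner (𝕜 := ℝ) (hA.op g) k).congr (hA.ae_inner_op g k)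

theorem inner_op (hA : IsBoundedCoeff A B) (g k : L2Vec) :
    inner ℝ (hA.op g) k = ∫ x, (A x *ᵥ (g x).ofLp) ⬝ᵥ (k x).ofLp := by
  rw [L2.inner_def]
  exact integral_congr_ae (hA.ae_inner_op g k)

theorem energyForm_eq (hA : IsBoundedCoeff A B) (u φ : H1) :
    energyForm A u φ = inner ℝ (hA.op (weakGrad u)) (weakGrad φ) :=
  (hA.inner_op _ _).symm

theorem inner_op_comm (hA : IsBoundedCoeff A B) (hs : ∀ᵐ x, (A x).IsSymm) (g k : L2Vec) :
    inner ℝ (hA.op g) k = inner ℝ (hA.op k) g := by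
  rw [hA.inner_op, hA.inner_op]
  refine integral_congr_ae ?_
  filter_upwards [hs] with x hx
  rw [dotProduct_comm, Matrix.dotProduct_mulVec, ← Matrix.mulVec_transpose, hx.eq]

theorem coercive_op (hA : IsBoundedCoeff A B) {c : ℝ}
    (hc : ∀ᵐ x, ∀ ξ : E3, c * ‖ξ‖ ^ 2 ≤ (A x *ᵥ ξ.ofLp) ⬝ᵥ ξ.ofLp) (g : L2Vec) :
    c * ‖g‖ ^ 2 ≤ inner ℝ (hA.op g) g := by
  rw [hA.inner_op, ← real_inner_self_eq_norm_sq, L2.inner_def, ← integral_const_mul]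
  refine integral_mono_ae ((L2.integrable_inner (𝕜 := ℝ) g g).const_mul c)
    (hA.integrable_form g g) ?_
  filter_upwards [hc] with x hx
  simpa only [real_inner_self_eq_norm_sq] using hx (g x)

/-- Multiplication by a uniformly elliptic coefficient is onto, by the Lax–Milgram theorem. -/
theorem exists_op_eq (hA : IsBoundedCoeff A B) {c : ℝ} (c0 : 0 < c)
    (hc : ∀ᵐ x, ∀ ξ : E3, c * ‖ξ‖ ^ 2 ≤ (A x *ᵥ ξ.ofLp) ⬝ᵥ ξ.ofLp) (y : L2Vec) :
    ∃ z, hA.op z = y := by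
  have hco : IsCoercive ((innerSL ℝ).comp hA.op : L2Vec →L[ℝ] L2Vec →L[ℝ] ℝ) :=
    ⟨c, c0, fun g => by
      have := hA.coercive_op hc g
      simpa [pow_two, mul_assoc] using this⟩
  refine ⟨hco.continuousLinearEquivOfBilin.symm y, ?_⟩
  refine ext_inner_right ℝ fun k => ?_
  have := hco.continuousLinearEquivOfBilin_apply (hco.continuousLinearEquivOfBilin.symm y) k
  rw [ContinuousLinearEquiv.apply_symm_apply] at this
  simpa using this.symm

end IsBoundedCoeff

/-! ### The background and the conductivity, and the inverse square root -/

theorem measurable_background (γp γm : ℝ) : Measurable (background γp γm) := by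
  have hm : Measurable fun x : E3 => x 2 := (EuclideanSpace.proj (𝕜 := ℝ) (2 : Fin 3)).measurable
  exact Measurable.ite (measurableSet_lt measurable_const hm) measurable_const measurable_const

theorem min_le_background (γp γm : ℝ) (x : E3) : min γp γm ≤ background γp γm x := by
  unfold background; split_ifs <;> simp

theorem abs_background_le (γp γm : ℝ) (x : E3) : |background γp γm x| ≤ max |γp| |γm| := by
  unfold background; split_ifs <;> simp

theorem isBoundedCoeff_background (γp γm : ℝ) :
    IsBoundedCoeff (fun x => background γp γm x • (1 : Matrix (Fin 3) (Fin 3) ℝ))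
      (max |γp| |γm|) where
  aestronglyMeasurable i j := by
    simp only [Matrix.smul_apply, smul_eq_mul]
    exact ((measurable_background γp γm).mul_const _).aestronglyMeasurable
  bound := by
    refine ae_of_all _ fun x i j => ?_
    rw [Matrix.smul_apply, smul_eq_mul, abs_mul, Matrix.one_apply]
    refine le_trans ?_ (abs_background_le γp γm x)
    split_ifs <;> simp

theorem smul_one_mulVec_dotProduct (a : ℝ) (ξ : E3) :
    ((a • (1 : Matrix (Fin 3) (Fin 3) ℝ)) *ᵥ ξ.ofLp) ⬝ᵥ ξ.ofLp = a * ‖ξ‖ ^ 2 := by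
  rw [Matrix.smul_mulVec, Matrix.one_mulVec, smul_dotProduct, smul_eq_mul,
    ← real_inner_self_eq_norm_sq, EuclideanSpace.inner_eq_star_dotProduct, star_trivial]

theorem coercive_background (γp γm : ℝ) (x ξ : E3) : min γp γm * ‖ξ‖ ^ 2 ≤
    ((background γp γm x • (1 : Matrix (Fin 3) (Fin 3) ℝ)) *ᵥ ξ.ofLp) ⬝ᵥ ξ.ofLp := by
  rw [smul_one_mulVec_dotProduct]
  exact mul_le_mul_of_nonneg_right (min_le_background γp γm x) (sq_nonneg _)

theorem exists_ae_abs_le {α : Type*} [MeasurableSpace α] {μ : Measure α} {g : α → ℝ}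
    (hg : MemLp g ∞ μ) : ∃ K : ℝ, 0 ≤ K ∧ ∀ᵐ x ∂μ, |g x| ≤ K := by
  refine ⟨(eLpNormEssSup g μ).toReal, ENNReal.toReal_nonneg, ?_⟩
  have hfin : eLpNormEssSup g μ ≠ ⊤ := by
    simpa using hg.eLpNorm_ne_top
  filter_upwards [enorm_ae_le_eLpNormEssSup g μ] with x hx
  simpa using ENNReal.toReal_mono hfin hx

section Conductivity

variable {γp γm : ℝ} {D : Set E3} {h : E3 → Matrix (Fin 3) (Fin 3) ℝ}

theorem exists_isBoundedCoeff_conductivity (hD : MeasurableSet D)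
    (hb : ∀ i j, MemLp (fun x => h x i j) ∞ (volume.restrict D)) :
    ∃ B, IsBoundedCoeff (conductivity γp γm D h) B := by
  choose K hK0 hK using fun i j => exists_ae_abs_le (hb i j)
  have hind : ∀ i j x, D.indicator h x i j = D.indicator (fun x => h x i j) x := by
    intro i j x
    by_cases hx : x ∈ D <;> simp [hx]
  refine ⟨max |γp| |γm| + ∑ i, ∑ j, K i j, ?_, ?_⟩
  · intro i j
    simp only [conductivity, Matrix.add_apply, hind]
    refine ((isBoundedCoeff_background γp γm).aestronglyMeasurable i j).add ?_
    exact (aestronglyMeasurable_indicator_iff hD).2 (hb i j).aestronglyMeasurable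
  · have hK' : ∀ᵐ x, x ∈ D → ∀ i j, |h x i j| ≤ K i j :=
      (ae_restrict_iff' hD).1 (ae_all_iff.2 fun i => ae_all_iff.2 fun j => hK i j)
    filter_upwards [hK', (isBoundedCoeff_background γp γm).bound] with x hx hx0 i j
    have hle : K i j ≤ ∑ i, ∑ j, K i j :=
      (Finset.single_le_sum (fun j _ => hK0 i j) (Finset.mem_univ j)).trans
        (Finset.single_le_sum (f := fun i => ∑ j, K i j)
          (fun i _ => Finset.sum_nonneg fun j _ => hK0 i j) (Finset.mem_univ i))
    simp only [conductivity, Matrix.add_apply, hind]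
    refine (abs_add_le _ _).trans (add_le_add (hx0 i j) ?_)
    by_cases hxD : x ∈ D
    · rw [indicator_of_mem hxD]
      exact (hx hxD i j).trans hle
    · rw [indicator_of_notMem hxD, abs_zero]
      exact (hK0 i j).trans hle

theorem ae_isSymm_conductivity (hD : MeasurableSet D)
    (hs : ∀ᵐ x ∂(volume.restrict D), (h x).IsSymm) :
    ∀ᵐ x, (conductivity γp γm D h x).IsSymm := by
  filter_upwards [(ae_restrict_iff' hD).1 hs] with x hx
  refine Matrix.IsSymm.add (Matrix.isSymm_one.smul _) ?_
  by_cases hxD : x ∈ D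
  · rw [indicator_of_mem hxD]
    exact hx hxD
  · rw [indicator_of_notMem hxD]
    exact Matrix.isSymm_zero

theorem exists_coercive_conductivity (hγp : 0 < γp) (hγm : 0 < γm) (hD : MeasurableSet D)
    (hpos : ∃ C : ℝ, 0 < C ∧ ∀ᵐ x ∂(volume.restrict D), ∀ ξ : E3,
      C * ‖ξ‖ ^ 2 ≤ (conductivity γp γm D h x *ᵥ ξ.ofLp) ⬝ᵥ ξ.ofLp) :
    ∃ c : ℝ, 0 < c ∧ ∀ᵐ x, ∀ ξ : E3,
      c * ‖ξ‖ ^ 2 ≤ (conductivity γp γm D h x *ᵥ ξ.ofLp) ⬝ᵥ ξ.ofLp := by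
  obtain ⟨C, hC, hCx⟩ := hpos
  refine ⟨min C (min γp γm), lt_min hC (lt_min hγp hγm), ?_⟩
  filter_upwards [(ae_restrict_iff' hD).1 hCx] with x hx ξ
  by_cases hxD : x ∈ D
  · exact (mul_le_mul_of_nonneg_right (min_le_left _ _) (sq_nonneg _)).trans (hx hxD ξ)
  · rw [conductivity, indicator_of_notMem hxD, add_zero]
    exact (mul_le_mul_of_nonneg_right (min_le_right _ _) (sq_nonneg _)).trans
      (coercive_background γp γm x ξ)

end Conductivity

theorem posDef_of_coercive {M : Matrix (Fin 3) (Fin 3) ℝ} (hs : M.IsSymm) {c : ℝ} (c0 : 0 < c)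
    (hc : ∀ ξ : E3, c * ‖ξ‖ ^ 2 ≤ (M *ᵥ ξ.ofLp) ⬝ᵥ ξ.ofLp) : M.PosDef := by
  refine Matrix.PosDef.of_dotProduct_mulVec_pos (by simpa [Matrix.IsHermitian] using hs.eq) ?_
  intro x hx
  have h1 := hc (WithLp.toLp 2 x)
  have h2 : 0 < ‖(WithLp.toLp 2 x : E3)‖ := norm_pos_iff.2 (by simpa using hx)
  rw [star_trivial, dotProduct_comm]
  exact lt_of_lt_of_le (by positivity) h1

theorem invSqrt_isSymm (M : Matrix (Fin 3) (Fin 3) ℝ) : (invSqrt M).IsSymm := by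
  have h : 0 ≤ invSqrt M := CFC.rpow_nonneg
  have hH := (Matrix.nonneg_iff_posSemidef.1 h).isHermitian.eq
  rwa [Matrix.conjTranspose_eq_transpose_of_trivial] at hH

theorem invSqrt_mul_invSqrt_mul {M : Matrix (Fin 3) (Fin 3) ℝ} (hM : M.PosDef) :
    invSqrt M * invSqrt M * M = 1 := by
  have h1 := CFC.rpow_neg_mul_rpow (a := M) 1 hM.isStrictlyPositive
  rw [CFC.rpow_one M hM.posSemidef.nonneg] at h1
  rwa [invSqrt, ← CFC.rpow_add hM.isUnit, show (-(1 / 2) + -(1 / 2) : ℝ) = -1 by norm_num]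

theorem invSqrt_mul_mul_invSqrt {M : Matrix (Fin 3) (Fin 3) ℝ} (hM : M.PosDef) :
    invSqrt M * M * invSqrt M = 1 := by
  have h := invSqrt_mul_invSqrt_mul hM
  rw [mul_assoc] at h
  exact mul_eq_one_comm.1 h

/-- If `z = a M⁻¹ k`, then `a (a - M) M^{-1/2} k · M^{-1/2} k = a k · z - a k · k`. -/
theorem invSqrt_form {M : Matrix (Fin 3) (Fin 3) ℝ} (hM : M.PosDef) (a : ℝ) {k z : Fin 3 → ℝ}
    (hz : M *ᵥ z = a • k) :
    a * (((a • 1 - M) *ᵥ (invSqrt M *ᵥ k)) ⬝ᵥ (invSqrt M *ᵥ k)) = (a • k) ⬝ᵥ z - (a • k) ⬝ᵥ k := by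
  have hS : ∀ y, y ⬝ᵥ (invSqrt M *ᵥ k) = (invSqrt M *ᵥ y) ⬝ᵥ k := fun y => by
    rw [Matrix.dotProduct_mulVec, ← Matrix.mulVec_transpose, (invSqrt_isSymm M).eq]
  have hz' : z = a • ((invSqrt M * invSqrt M) *ᵥ k) := by
    rw [← Matrix.mulVec_smul, ← hz, Matrix.mulVec_mulVec, invSqrt_mul_invSqrt_mul hM,
      Matrix.one_mulVec]
  rw [hS, hz', Matrix.mulVec_mulVec, Matrix.mulVec_mulVec, Matrix.mul_sub, Matrix.sub_mul,
    invSqrt_mul_mul_invSqrt hM, Matrix.mul_smul, Matrix.smul_mul, mul_one, Matrix.sub_mulVec,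
    Matrix.smul_mulVec, Matrix.one_mulVec, sub_dotProduct]
  simp only [smul_dotProduct, dotProduct_smul, smul_eq_mul]
  rw [dotProduct_comm k ((invSqrt M * invSqrt M) *ᵥ k)]
  ring

/-! ### Completeness of `H¹(ℝ³)` -/

/-- For a fixed test function, the identity defining the weak gradient is a closed condition: tested
against a vector `e`, it is an equation between inner products with fixed `L²` functions. -/
theorem isClosed_weakGradient_identity {φ : E3 → ℝ} (hφ : ContDiff ℝ ∞ φ)
    (hc : HasCompactSupport φ) : IsClosed {p : WithLp 2 (L2 × L2Vec) |
      ∫ x, p.fst x • gradient φ x = -∫ x, φ x • p.snd x} := by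
  have hcont : Continuous (gradient φ) :=
    (InnerProductSpace.toDual ℝ E3).symm.continuous.comp (hφ.continuous_fderiv (by simp))
  have hsupp : HasCompactSupport (gradient φ) :=
    (hc.fderiv ℝ).comp_left (g := (InnerProductSpace.toDual ℝ E3).symm) (by simp)
  have hG : ∀ e : E3, MemLp (fun x => inner ℝ e (gradient φ x)) 2 (volume : Measure E3) :=
    fun e => (hcont.memLp_of_hasCompactSupport hsupp).const_inner e
  have hΦ : ∀ e : E3, MemLp (fun x => φ x • e) 2 (volume : Measure E3) := fun e =>
    (hφ.continuous.smul continuous_const).memLp_of_hasCompactSupport (hc.smul_right)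
  have h1 : ∀ (q : L2) (e : E3),
      inner ℝ e (∫ x, q x • gradient φ x) = inner ℝ ((hG e).toLp _) q := by
    intro q e
    rw [← integral_inner (integrable_smul_gradient q hφ hc), L2.inner_def]
    refine integral_congr_ae ?_
    filter_upwards [(hG e).coeFn_toLp] with x hx
    rw [hx, inner_smul_right, real_inner_comm]
    simp
  have h2 : ∀ (q : L2Vec) (e : E3),
      inner ℝ e (∫ x, φ x • q x) = inner ℝ ((hΦ e).toLp _) q := by
    intro q e
    rw [← integral_inner (integrable_testFunction_smul q hφ hc), L2.inner_def]
    refine integral_congr_ae ?_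
    filter_upwards [(hΦ e).coeFn_toLp] with x hx
    simp [hx, inner_smul_right, inner_smul_left]
  have hset : {p : WithLp 2 (L2 × L2Vec) |
      ∫ x, p.fst x • gradient φ x = -∫ x, φ x • p.snd x} =
      ⋂ e : E3, {p | inner ℝ ((hG e).toLp _) (WithLp.fstL 2 ℝ L2 L2Vec p) =
        -inner ℝ ((hΦ e).toLp _) (WithLp.sndL 2 ℝ L2 L2Vec p)} := by
    ext p
    simp only [mem_ofPred_eq, mem_iInter]
    constructor
    · intro hp e
      have := congrArg (inner ℝ e) hp
      rw [inner_neg_right, h1, h2] at this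
      exact this
    · intro hp
      refine ext_inner_left ℝ fun e => ?_
      rw [inner_neg_right, h1, h2]
      exact hp e
  rw [hset]
  refine isClosed_iInter fun e => isClosed_eq ?_ ?_
  · exact continuous_const.inner (WithLp.fstL 2 ℝ L2 L2Vec).continuous
  · exact (continuous_const.inner (WithLp.sndL 2 ℝ L2 L2Vec).continuous).neg

theorem isClosed_H1 : IsClosed (H1 : Set (WithLp 2 (L2 × L2Vec))) := by
  have : (H1 : Set (WithLp 2 (L2 × L2Vec))) = ⋂ (φ : E3 → ℝ) (_ : ContDiff ℝ ∞ φ)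
      (_ : HasCompactSupport φ), {p : WithLp 2 (L2 × L2Vec) |
        ∫ x, p.fst x • gradient φ x = -∫ x, φ x • p.snd x} := by
    ext p
    simp only [mem_iInter]
    rfl
  rw [this]
  exact isClosed_iInter fun φ => isClosed_iInter fun hφ => isClosed_iInter fun hc =>
    isClosed_weakGradient_identity hφ hc

/-- Completeness of `H¹(ℝ³)` is what makes Bochner integrals of `H¹`-valued functions meaningful. -/
instance : CompleteSpace H1 := isClosed_H1.completeSpace_coe

/-- The embedding `H¹(ℝ³) → L²(ℝ³)`. -/
noncomputable def toL2CLM : H1 →L[ℝ] L2 := (WithLp.fstL 2 ℝ L2 L2Vec).comp H1.subtypeL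

/-- The weak gradient as a bounded operator `H¹(ℝ³) → L²(ℝ³)³`. -/
noncomputable def weakGradCLM : H1 →L[ℝ] L2Vec := (WithLp.sndL 2 ℝ L2 L2Vec).comp H1.subtypeL

theorem toL2_eq_CLM (u : H1) : toL2 u = toL2CLM u := rfl

/-! ### Test functions that vanish at the final time -/

/-- The derivative of the smooth transition function is bounded, and vanishes beyond the transition. -/
theorem exists_abs_deriv_smoothTransition_le :
    ∃ S : ℝ, 0 ≤ S ∧ ∀ x, |deriv Real.smoothTransition x| ≤ S ∧
      (1 < x → deriv Real.smoothTransition x = 0) := by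
  have hcont : Continuous (deriv Real.smoothTransition) :=
    (Real.smoothTransition.contDiff (n := ⊤)).continuous_deriv (by simp)
  obtain ⟨S, hS⟩ := (isCompact_Icc (a := (0 : ℝ)) (b := 1)).exists_bound_of_continuousOn
    hcont.continuousOn
  have hS0 : 0 ≤ S := (norm_nonneg _).trans (hS 0 (by simp))
  have h1 : ∀ x : ℝ, 1 < x → deriv Real.smoothTransition x = 0 := fun x hx => by
    have : Real.smoothTransition =ᶠ[𝓝 x] fun _ => 1 := by
      filter_upwards [lt_mem_nhds hx] with y hy
      exact Real.smoothTransition.one_of_one_le hy.le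
    rw [this.deriv_eq, deriv_const]
  refine ⟨S, hS0, fun x => ⟨?_, h1 x⟩⟩
  rcases lt_or_ge x 0 with hx | hx
  · have : Real.smoothTransition =ᶠ[𝓝 x] fun _ => 0 := by
      filter_upwards [gt_mem_nhds hx] with y hy
      exact Real.smoothTransition.zero_of_nonpos hy.le
    rw [this.deriv_eq, deriv_const, abs_zero]
    exact hS0
  rcases lt_or_ge 1 x with hx1 | hx1
  · rw [h1 x hx1, abs_zero]
    exact hS0
  · exact hS x ⟨hx, hx1⟩

/-- A smooth cutoff in time: it is `1` for `t ≤ T - 2 / n` and `0` for `t ≥ T - 1 / n`. -/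
noncomputable def endCutoff (T : ℝ) (n : ℕ) (t : ℝ) : ℝ := Real.smoothTransition (n * (T - t) - 1)

theorem contDiff_endCutoff (T : ℝ) (n : ℕ) : ContDiff ℝ ∞ (endCutoff T n) :=
  Real.smoothTransition.contDiff.comp (by fun_prop)

theorem hasDerivAt_endCutoff (T : ℝ) (n : ℕ) (t : ℝ) :
    HasDerivAt (endCutoff T n) (deriv Real.smoothTransition (n * (T - t) - 1) * -n) t := by
  have h1 : HasDerivAt (fun t : ℝ => (n : ℝ) * (T - t) - 1) (-n) t := by
    simpa using (((hasDerivAt_id t).const_sub T).const_mul (n : ℝ)).sub_const 1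
  have h2 : HasDerivAt Real.smoothTransition
      (deriv Real.smoothTransition (n * (T - t) - 1)) (n * (T - t) - 1) :=
    ((Real.smoothTransition.contDiff (n := ⊤)).differentiable (by simp) _).hasDerivAt
  exact h2.comp t h1

theorem endCutoff_nonneg (T : ℝ) (n : ℕ) (t : ℝ) : 0 ≤ endCutoff T n t :=
  Real.smoothTransition.nonneg _

theorem endCutoff_le_one (T : ℝ) (n : ℕ) (t : ℝ) : endCutoff T n t ≤ 1 :=
  Real.smoothTransition.le_one _

theorem tsupport_endCutoff_mul_subset (T : ℝ) {n : ℕ} (hn : 0 < n) (ψ : ℝ → ℝ) :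
    tsupport (fun t => ψ t * endCutoff T n t) ⊆ Iio T := by
  have hn' : (0 : ℝ) < n := by exact_mod_cast hn
  have hsub : Function.support (fun t => ψ t * endCutoff T n t) ⊆ Iic (T - 1 / n) := by
    intro t ht
    by_contra hlt
    refine ht ?_
    have h1 : T - t < 1 / n := by
      have := not_le.1 (mt mem_Iic.2 hlt)
      linarith
    have h2 : (n : ℝ) * (T - t) < 1 := by
      rwa [lt_div_iff₀' hn'] at h1
    have : endCutoff T n t = 0 := Real.smoothTransition.zero_of_nonpos (by linarith)
    simp [this]
  refine (closure_minimal hsub isClosed_Iic).trans fun t ht => ?_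
  have : (0 : ℝ) < 1 / n := by positivity
  exact lt_of_le_of_lt (mem_Iic.1 ht) (by linarith)

theorem eventually_endCutoff_eq_one {T t : ℝ} (ht : t < T) :
    ∀ᶠ n : ℕ in atTop, endCutoff T n =ᶠ[𝓝 t] fun _ => 1 := by
  have hT : 0 < T - t := sub_pos.2 ht
  obtain ⟨N, hN⟩ := exists_nat_gt (2 / (T - t))
  filter_upwards [eventually_ge_atTop N] with n hn
  have h1 : 2 < (n : ℝ) * (T - t) := by
    rw [← div_lt_iff₀ hT]
    exact hN.trans_le (by exact_mod_cast hn)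
  have hcont : Continuous fun s : ℝ => (n : ℝ) * (T - s) := by fun_prop
  filter_upwards [hcont.continuousAt.eventually (lt_mem_nhds h1)] with s hs
  exact Real.smoothTransition.one_of_one_le (by linarith)

/-- If `ψ(T) = 0`, then multiplying `ψ` by the cutoffs keeps it bounded in `C¹`, uniformly in `n`. -/
theorem exists_abs_deriv_mul_endCutoff_le {T : ℝ} (hT : 0 < T) {ψ : ℝ → ℝ}
    (hψ : ContDiff ℝ ∞ ψ) (hψT : ψ T = 0) :
    ∃ K : ℝ, ∀ (n : ℕ), ∀ t ∈ Ioo 0 T, |ψ t * endCutoff T n t| ≤ K ∧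
      |deriv (fun t => ψ t * endCutoff T n t) t| ≤ K := by
  obtain ⟨S, hS0, hS⟩ := exists_abs_deriv_smoothTransition_le
  have hcont : Continuous (deriv ψ) := hψ.continuous_deriv (by simp)
  obtain ⟨K, hK⟩ := (isCompact_Icc (a := (0 : ℝ)) (b := T)).exists_bound_of_continuousOn
    hcont.continuousOn
  have hK0 : 0 ≤ K := (norm_nonneg _).trans (hK 0 ⟨le_rfl, hT.le⟩)
  have hlip : ∀ t ∈ Ioo 0 T, |ψ t| ≤ K * (T - t) := by
    intro t ht
    have := Convex.norm_image_sub_le_of_norm_deriv_le (f := ψ) (s := Icc 0 T) (C := K)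
      (fun x _ => hψ.differentiable (by simp) x) hK (convex_Icc 0 T)
      ⟨ht.1.le, ht.2.le⟩ ⟨hT.le, le_rfl⟩
    rwa [hψT, zero_sub, norm_neg, Real.norm_eq_abs, Real.norm_eq_abs,
      abs_of_pos (sub_pos.2 ht.2)] at this
  refine ⟨K * T + (K + 2 * K * S), fun n t ht => ?_⟩
  have hTt : 0 < T - t := sub_pos.2 ht.2
  have hχ : |endCutoff T n t| ≤ 1 := by
    rw [abs_of_nonneg (endCutoff_nonneg T n t)]
    exact endCutoff_le_one T n t
  have hψt : |ψ t| ≤ K * T := (hlip t ht).trans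
    (mul_le_mul_of_nonneg_left (by linarith [ht.1]) hK0)
  constructor
  · rw [abs_mul]
    have h1 : |ψ t| * |endCutoff T n t| ≤ |ψ t| * 1 :=
      mul_le_mul_of_nonneg_left hχ (abs_nonneg _)
    have : 0 ≤ 2 * K * S := by positivity
    linarith
  · have hd : HasDerivAt ψ (deriv ψ t) t := (hψ.differentiable (by simp) t).hasDerivAt
    have hd' : deriv (fun t => ψ t * endCutoff T n t) t = _ :=
      (hd.mul (hasDerivAt_endCutoff T n t)).deriv
    rw [hd']
    have h1 : |deriv ψ t * endCutoff T n t| ≤ K := by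
      rw [abs_mul]
      calc _ ≤ K * 1 := mul_le_mul (hK t ⟨ht.1.le, ht.2.le⟩) hχ (abs_nonneg _) hK0
        _ = K := mul_one K
    -- The derivative of the cutoff has size `n`, but only at distance `≤ 2 / n` from `T`,
    -- where `ψ` is of size `1 / n`.
    have h2 : |ψ t * (deriv Real.smoothTransition (n * (T - t) - 1) * -n)| ≤ 2 * K * S := by
      rcases lt_or_ge 1 ((n : ℝ) * (T - t) - 1) with hlt | hge
      · rw [(hS _).2 hlt]
        simp only [zero_mul, mul_zero, abs_zero]
        positivity
      · rw [abs_mul, abs_mul, abs_neg, Nat.abs_cast]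
        calc _ ≤ K * (T - t) * (S * n) := by
              refine mul_le_mul (hlip t ht) ?_ (by positivity) (by positivity)
              exact mul_le_mul_of_nonneg_right (hS _).1 (by positivity)
          _ = K * S * (n * (T - t)) := by ring
          _ ≤ K * S * 2 := mul_le_mul_of_nonneg_left (by linarith) (by positivity)
          _ = 2 * K * S := by ring
    have h3 := abs_add_le (deriv ψ t * endCutoff T n t)
      (ψ t * (deriv Real.smoothTransition (n * (T - t) - 1) * -n))
    have h4 : 0 ≤ K * T := by positivity
    linarith

/-- A distributional identity for test functions that vanish near `T` extends to test functions that
vanish at `T` only. The hypothesis says that `b' = -e` on `(0, T)` and `b(0) = c`. -/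
theorem integral_test_of_vanishing_at_end {E : Type*} [NormedAddCommGroup E] [NormedSpace ℝ E]
    {T : ℝ} (hT : 0 < T) {b e : ℝ → E} (hb : IntegrableOn b (Ioo 0 T))
    (he : IntegrableOn e (Ioo 0 T)) {c : E}
    (H : ∀ ψ : ℝ → ℝ, ContDiff ℝ ∞ ψ → tsupport ψ ⊆ Iio T →
      ∫ t in Ioo 0 T, (-(deriv ψ t • b t) + ψ t • e t) = ψ 0 • c)
    {ψ : ℝ → ℝ} (hψ : ContDiff ℝ ∞ ψ) (hψT : ψ T = 0) :
    ∫ t in Ioo 0 T, (-(deriv ψ t • b t) + ψ t • e t) = ψ 0 • c := by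
  obtain ⟨K, hK⟩ := exists_abs_deriv_mul_endCutoff_le hT hψ hψT
  set χ : ℕ → ℝ → ℝ := fun n t => ψ t * endCutoff T n t with hχ
  have hχd : ∀ n, ContDiff ℝ ∞ (χ n) := fun n => hψ.mul (contDiff_endCutoff T n)
  have hev : ∀ t, t < T → ∀ᶠ n in atTop, χ n =ᶠ[𝓝 t] ψ := fun t ht => by
    filter_upwards [eventually_endCutoff_eq_one ht] with n hn
    filter_upwards [hn] with s hs
    simp [hχ, hs]
  have hlim : Tendsto (fun n => ∫ t in Ioo 0 T, (-(deriv (χ n) t • b t) + χ n t • e t)) atTop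
      (𝓝 (∫ t in Ioo 0 T, (-(deriv ψ t • b t) + ψ t • e t))) := by
    refine tendsto_integral_of_dominated_convergence (fun t => K * ‖b t‖ + K * ‖e t‖) ?_ ?_ ?_ ?_
    · intro n
      have h1 : Continuous (deriv (χ n)) := (hχd n).continuous_deriv (by simp)
      exact (h1.aestronglyMeasurable.smul hb.aestronglyMeasurable).neg.add
        ((hχd n).continuous.aestronglyMeasurable.smul he.aestronglyMeasurable)
    · exact (hb.norm.const_mul K).add (he.norm.const_mul K)
    · intro n
      filter_upwards [ae_restrict_mem measurableSet_Ioo] with t ht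
      refine (norm_add_le _ _).trans ?_
      rw [norm_neg, norm_smul, norm_smul]
      exact add_le_add (mul_le_mul_of_nonneg_right (hK n t ht).2 (norm_nonneg _))
        (mul_le_mul_of_nonneg_right (hK n t ht).1 (norm_nonneg _))
    · filter_upwards [ae_restrict_mem measurableSet_Ioo] with t ht
      refine tendsto_const_nhds.congr' ?_
      filter_upwards [hev t ht.2] with n hn
      rw [hn.deriv_eq, hn.eq_of_nhds]
  have hlim' : Tendsto (fun n => ∫ t in Ioo 0 T, (-(deriv (χ n) t • b t) + χ n t • e t)) atTop
      (𝓝 (ψ 0 • c)) := by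
    refine tendsto_const_nhds.congr' ?_
    filter_upwards [hev 0 hT, eventually_gt_atTop 0] with n hn hn0
    rw [H _ (hχd n) (tsupport_endCutoff_mul_subset T hn0 ψ), hn.eq_of_nhds]
  exact tendsto_nhds_unique hlim hlim'

/-! ### The equation of the truncated Laplace transform -/

theorem inner_L2_eq (f g : L2) : inner ℝ f g = ∫ x, f x * g x := by
  rw [L2.inner_def]
  refine integral_congr_ae (ae_of_all _ fun x => ?_)
  simp [mul_comm]

theorem contDiff_exp_sub (τ T : ℝ) :
    ContDiff ℝ ∞ fun t : ℝ => Real.exp (-τ * t) - Real.exp (-τ * T) := by fun_prop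

theorem deriv_exp_sub (τ T t : ℝ) :
    deriv (fun t : ℝ => Real.exp (-τ * t) - Real.exp (-τ * T)) t = -τ * Real.exp (-τ * t) := by
  have h1 : HasDerivAt (fun t : ℝ => -τ * t) (-τ) t := by
    simpa using (hasDerivAt_id t).const_mul (-τ)
  rw [(h1.exp.sub_const _).deriv, mul_comm]

theorem integrableOn_Ioo_smul {E : Type*} [NormedAddCommGroup E] [NormedSpace ℝ E] {T : ℝ}
    {g : ℝ → ℝ} (hg : Continuous g) {b : ℝ → E} (hb : IntegrableOn b (Ioo 0 T)) :
    IntegrableOn (fun t => g t • b t) (Ioo 0 T) :=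
  hb.continuousOn_smul_of_subset hg.continuousOn isCompact_Icc measurableSet_Ioo
    Ioo_subset_Icc_self

/-- Truncated Laplace transform of the equation `b' = -e`, `b(0) = c`. The last term stands for
`e^{-τT} b(T)`, as `b(T) = c - ∫₀ᵀ e`. -/
theorem integral_exp_of_test {E : Type*} [NormedAddCommGroup E] [NormedSpace ℝ E]
    {T : ℝ} (hT : 0 < T) (τ : ℝ) {b e : ℝ → E} (hb : IntegrableOn b (Ioo 0 T))
    (he : IntegrableOn e (Ioo 0 T)) {c : E}
    (H : ∀ ψ : ℝ → ℝ, ContDiff ℝ ∞ ψ → tsupport ψ ⊆ Iio T →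
      ∫ t in Ioo 0 T, (-(deriv ψ t • b t) + ψ t • e t) = ψ 0 • c) :
    τ • (∫ t in Ioo 0 T, Real.exp (-τ * t) • b t) + (∫ t in Ioo 0 T, Real.exp (-τ * t) • e t)
      = c - Real.exp (-τ * T) • (c - ∫ t in Ioo 0 T, e t) := by
  have h := integral_test_of_vanishing_at_end hT hb he H (contDiff_exp_sub τ T) (sub_self _)
  have hi : ∀ t, -(deriv (fun t : ℝ => Real.exp (-τ * t) - Real.exp (-τ * T)) t • b t)
      + (Real.exp (-τ * t) - Real.exp (-τ * T)) • e t
      = τ • (Real.exp (-τ * t) • b t) + (Real.exp (-τ * t) • e t - Real.exp (-τ * T) • e t) := by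
    intro t
    rw [deriv_exp_sub]
    module
  simp only [hi] at h
  have hexp : Continuous fun t : ℝ => Real.exp (-τ * t) := by fun_prop
  have hb' : IntegrableOn (fun t => τ • (Real.exp (-τ * t) • b t)) (Ioo 0 T) :=
    (integrableOn_Ioo_smul hexp hb).smul τ
  have he' := integrableOn_Ioo_smul hexp he
  have he'' : IntegrableOn (fun t => Real.exp (-τ * T) • e t) (Ioo 0 T) := he.smul _
  have hsub : IntegrableOn (fun t => Real.exp (-τ * t) • e t - Real.exp (-τ * T) • e t)
      (Ioo 0 T) := he'.sub he''
  rw [integral_add hb' hsub, integral_sub he' he'',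
    integral_smul, integral_smul, mul_zero, Real.exp_zero] at h
  linear_combination (norm := module) h

/-- The functional `φ ↦ ⟨∂ₜu(T) + τ u(T), φ⟩`, expressed through `U = ∫₀ᵀ u` and `P = ∫₀ᵀ ∂ₜu` by
`u(T) = P` and `⟨∂ₜu(T), φ⟩ = (f, φ) - ∫ A∇U · ∇φ dx`, so that no traces in time are needed. -/
noncomputable def residual (A : E3 → Matrix (Fin 3) (Fin 3) ℝ) (f : L2) (U : H1) (P : L2) (τ : ℝ)
    (φ : H1) : ℝ :=
  inner ℝ f (toL2 φ) - energyForm A U φ + τ * inner ℝ P (toL2 φ)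

/-- The truncated Laplace transform of a weak solution of the wave equation is in `H¹(ℝ³)`, and solves
`(∇·A∇ - τ²)w + f = e^{-τT} (∂ₜu(T) + τ u(T))` weakly. -/
theorem exists_truncatedLaplace_eq {A : E3 → Matrix (Fin 3) (Fin 3) ℝ} {B : ℝ}
    (hA : IsBoundedCoeff A B) (hs : ∀ᵐ x, (A x).IsSymm) {T : ℝ} (hT : 0 < T) {f : L2}
    {u : ℝ → H1} (hu : IsWeakWaveSolution A T f u) :
    ∃ (U : H1) (P : L2), ∀ τ : ℝ, ∃ w : H1, toL2 w = truncatedLaplace T τ u ∧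
      ∀ φ : H1, energyForm A w φ + τ ^ 2 * inner ℝ (toL2 w) (toL2 φ)
        = inner ℝ f (toL2 φ) - Real.exp (-τ * T) * residual A f U P τ φ := by
  obtain ⟨hu2, p, hp2, hup, hpe⟩ := hu
  have hui : IntegrableOn u (Ioo 0 T) := hu2.integrable one_le_two
  have hpi : IntegrableOn p (Ioo 0 T) := hp2.integrable one_le_two
  have hvi : IntegrableOn (fun t => toL2 (u t)) (Ioo 0 T) := toL2CLM.integrable_comp hui
  have hexp : ∀ τ : ℝ, Continuous fun t : ℝ => Real.exp (-τ * t) := fun τ => by fun_prop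
  refine ⟨∫ t in Ioo 0 T, u t, ∫ t in Ioo 0 T, p t, fun τ => ?_⟩
  have hW : toL2 (∫ t in Ioo 0 T, Real.exp (-τ * t) • u t)
      = ∫ t in Ioo 0 T, Real.exp (-τ * t) • toL2 (u t) := by
    rw [toL2_eq_CLM, ← ContinuousLinearMap.integral_comp_comm _
      (integrableOn_Ioo_smul (hexp τ) hui)]
    simp only [map_smul]
    rfl
  refine ⟨∫ t in Ioo 0 T, Real.exp (-τ * t) • u t, ?_, fun φ => ?_⟩
  · rw [hW, truncatedLaplace, intervalIntegral.integral_of_le hT.le, integral_Ioc_eq_integral_Ioo]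
  -- `E(·, φ)` as a continuous linear functional on `H¹`
  set ℓ : H1 →L[ℝ] ℝ := (innerSL ℝ (hA.op (weakGrad φ))).comp weakGradCLM with hℓ
  have hE : ∀ y : H1, energyForm A y φ = ℓ y := fun y => by
    rw [hA.energyForm_eq, hA.inner_op_comm hs]
    rfl
  set m : L2 →L[ℝ] ℝ := innerSL ℝ (toL2 φ) with hm
  have hM : ∀ y : L2, inner ℝ y (toL2 φ) = m y := fun y => (real_inner_comm _ _)
  -- the equation `p = ∂ₜu`, `u(0) = 0`
  have h1 := integral_exp_of_test (c := (0 : L2)) hT τ hvi hpi.neg (fun ψ hψ hψT => by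
    have hcd : Continuous (deriv ψ) := hψ.continuous_deriv (by simp)
    rw [smul_zero, integral_add (f := fun t => -(deriv ψ t • toL2 (u t)))
      (g := fun t => ψ t • (-p) t) (integrableOn_Ioo_smul hcd hvi).neg
      (integrableOn_Ioo_smul hψ.continuous hpi.neg), integral_neg, hup ψ hψ hψT]
    simp [integral_neg])
  have h2 := integral_exp_of_test (c := inner ℝ f (toL2 φ)) hT τ (m.integrable_comp hpi)
    (ℓ.integrable_comp hui) (fun ψ hψ hψT => by
      have := hpe φ ψ hψ hψT
      simp only [smul_eq_mul, ← hM, ← hE, inner_L2_eq]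
      exact this)
  have h1' := congrArg m h1
  simp only [Pi.neg_apply, smul_neg, integral_neg, sub_neg_eq_add, zero_add, zero_sub, map_add,
    map_neg, map_smul, smul_eq_mul, ← hW] at h1'
  have hQ : ∫ t in Ioo 0 T, Real.exp (-τ * t) • m (p t)
      = m (∫ t in Ioo 0 T, Real.exp (-τ * t) • p t) := by
    rw [← ContinuousLinearMap.integral_comp_comm _ (integrableOn_Ioo_smul (hexp τ) hpi)]
    simp only [map_smul]
  have hL : ∫ t in Ioo 0 T, Real.exp (-τ * t) • ℓ (u t)
      = ℓ (∫ t in Ioo 0 T, Real.exp (-τ * t) • u t) := by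
    rw [← ContinuousLinearMap.integral_comp_comm _ (integrableOn_Ioo_smul (hexp τ) hui)]
    simp only [map_smul]
  rw [hQ, hL, ContinuousLinearMap.integral_comp_comm ℓ hui, smul_eq_mul, smul_eq_mul] at h2
  simp only [residual, hE, hM] at h2 ⊢
  linear_combination h2 + τ * h1'

/-! ### Energy estimates -/

theorem add_le_of_quadratic_le {c a b τ x y : ℝ} (hc : 0 < c) (hc1 : c ≤ 1)
    (ha : 0 ≤ a) (hb : 0 ≤ b) (hτ : 0 < τ) (hx : 0 ≤ x) (hy : 0 ≤ y)
    (h : c * x ^ 2 + τ ^ 2 * y ^ 2 ≤ a * y + b / τ * (x + τ * y)) :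
    x + τ * y ≤ 2 * (a + b) / c / τ := by
  have hτy : 0 ≤ τ * y := by positivity
  rcases (add_nonneg hx hτy).eq_or_lt with h0 | h0
  · rw [← h0]
    positivity
  have h1 : a * y ≤ a / τ * (x + τ * y) := by
    have : a / τ * (x + τ * y) = a * y + a / τ * x := by field_simp; ring
    rw [this]
    have : 0 ≤ a / τ * x := by positivity
    linarith
  have h2 : c * (x + τ * y) ^ 2 ≤ 2 * (c * x ^ 2 + τ ^ 2 * y ^ 2) := by
    have e1 : c * (x + τ * y) ^ 2 ≤ c * (2 * (x ^ 2 + (τ * y) ^ 2)) :=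
      mul_le_mul_of_nonneg_left (by nlinarith [sq_nonneg (x - τ * y)]) hc.le
    have e2 : c * (τ * y) ^ 2 ≤ 1 * (τ * y) ^ 2 := mul_le_mul_of_nonneg_right hc1 (sq_nonneg _)
    nlinarith
  have h3 : c * (x + τ * y) ^ 2 ≤ 2 * ((a + b) / τ) * (x + τ * y) := by
    rw [add_div]
    nlinarith
  have h4 : c * (x + τ * y) ≤ 2 * ((a + b) / τ) := by
    refine le_of_mul_le_mul_right ?_ h0
    linarith [h3]
  rw [le_div_iff₀ hτ, le_div_iff₀ hc]
  have h5 := mul_le_mul_of_nonneg_right h4 hτ.le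
  have : 2 * ((a + b) / τ) * τ = 2 * (a + b) := by field_simp
  linarith

section Energy

variable {A : E3 → Matrix (Fin 3) (Fin 3) ℝ} {B c : ℝ}

theorem abs_energyForm_le (hA : IsBoundedCoeff A B) (u φ : H1) :
    |energyForm A u φ| ≤ ‖hA.op (weakGrad u)‖ * ‖weakGrad φ‖ := by
  rw [hA.energyForm_eq]
  exact abs_real_inner_le_norm _ _

theorem coercive_energyForm (hA : IsBoundedCoeff A B)
    (hc : ∀ᵐ x, ∀ ξ : E3, c * ‖ξ‖ ^ 2 ≤ (A x *ᵥ ξ.ofLp) ⬝ᵥ ξ.ofLp) (u : H1) :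
    c * ‖weakGrad u‖ ^ 2 ≤ energyForm A u u := by
  rw [hA.energyForm_eq]
  exact hA.coercive_op hc _

/-- If `y` solves the elliptic equation up to an error of size `b / τ`,
then `‖∇y‖ + τ‖y‖ = O(1 / τ)`. -/
theorem norm_add_le_of_energy_le (hA : IsBoundedCoeff A B) (c0 : 0 < c) (c1 : c ≤ 1)
    (hc : ∀ᵐ x, ∀ ξ : E3, c * ‖ξ‖ ^ 2 ≤ (A x *ᵥ ξ.ofLp) ⬝ᵥ ξ.ofLp) {f : L2} {b τ : ℝ}
    (hb : 0 ≤ b) (hτ : 0 < τ) {y : H1}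
    (h : energyForm A y y + τ ^ 2 * inner ℝ (toL2 y) (toL2 y)
      ≤ inner ℝ f (toL2 y) + b / τ * (‖weakGrad y‖ + τ * ‖toL2 y‖)) :
    ‖weakGrad y‖ + τ * ‖toL2 y‖ ≤ 2 * (‖f‖ + b) / c / τ := by
  refine add_le_of_quadratic_le c0 c1 (norm_nonneg f) hb hτ (norm_nonneg _) (norm_nonneg _) ?_
  have h1 := coercive_energyForm hA hc y
  have h2 := real_inner_le_norm f (toL2 y)
  rw [real_inner_self_eq_norm_sq] at h
  linarith

theorem energyForm_sub_sub (hA : IsBoundedCoeff A B) (hs : ∀ᵐ x, (A x).IsSymm) (w v : H1) :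
    energyForm A (w - v) (w - v)
      = energyForm A w w - 2 * energyForm A w v + energyForm A v v := by
  have h1 : weakGrad (w - v) = weakGrad w - weakGrad v := rfl
  simp only [hA.energyForm_eq, h1, map_sub, inner_sub_left, inner_sub_right]
  rw [hA.inner_op_comm hs (weakGrad v) (weakGrad w)]
  ring

end Energy

theorem exists_abs_residual_le {A : E3 → Matrix (Fin 3) (Fin 3) ℝ} {B : ℝ}
    (hA : IsBoundedCoeff A B) (f : L2) (U : H1) (P : L2) :
    ∃ K : ℝ, 0 ≤ K ∧ ∀ τ : ℝ, 1 ≤ τ → ∀ φ : H1,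
      |residual A f U P τ φ| ≤ K * (‖weakGrad φ‖ + τ * ‖toL2 φ‖) := by
  refine ⟨‖f‖ + ‖hA.op (weakGrad U)‖ + ‖P‖, by positivity, fun τ hτ φ => ?_⟩
  have h1 := abs_real_inner_le_norm f (toL2 φ)
  have h2 := abs_energyForm_le hA U φ
  have h3 : |τ * inner ℝ P (toL2 φ)| ≤ τ * (‖P‖ * ‖toL2 φ‖) := by
    rw [abs_mul, abs_of_nonneg (by linarith : 0 ≤ τ)]
    exact mul_le_mul_of_nonneg_left (abs_real_inner_le_norm _ _) (by linarith)
  have h4 : |residual A f U P τ φ| ≤ |inner ℝ f (toL2 φ)| + |energyForm A U φ|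
      + |τ * inner ℝ P (toL2 φ)| := (abs_add_le _ _).trans (by gcongr; exact abs_sub _ _)
  have h5 : ‖f‖ * ‖toL2 φ‖ ≤ ‖f‖ * (τ * ‖toL2 φ‖) := by
    gcongr
    exact le_mul_of_one_le_left (norm_nonneg _) hτ
  have h6 : 0 ≤ ‖f‖ * ‖weakGrad φ‖ := by positivity
  have h7 : 0 ≤ ‖hA.op (weakGrad U)‖ * (τ * ‖toL2 φ‖) := by positivity
  have h8 : 0 ≤ ‖P‖ * ‖weakGrad φ‖ := by positivity
  linarith

theorem exp_neg_le_div {τ T : ℝ} (hτ : 0 < τ) (hT : 0 < T) :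
    Real.exp (-τ * T) ≤ 1 / T / τ := by
  have h : τ * T ≤ Real.exp (τ * T) := by linarith [Real.add_one_le_exp (τ * T)]
  rw [neg_mul, Real.exp_neg, div_div, one_div, mul_comm T]
  exact inv_anti₀ (by positivity) h

theorem isBigO_exp_mul {T L : ℝ} {F : ℝ → ℝ} (hF : ∀ τ, 1 ≤ τ → |F τ| ≤ L / τ) :
    (fun τ => Real.exp (-τ * T) * F τ) =O[atTop] fun τ : ℝ => τ⁻¹ * Real.exp (-τ * T) := by
  refine Asymptotics.IsBigO.of_bound L ?_
  filter_upwards [eventually_ge_atTop 1] with τ hτ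
  have hτ0 : 0 < τ := by linarith
  simp only [norm_mul, Real.norm_eq_abs]
  rw [Real.abs_exp, abs_of_pos (inv_pos.2 hτ0)]
  calc _ ≤ Real.exp (-τ * T) * (L / τ) := mul_le_mul_of_nonneg_left (hF τ hτ) (Real.exp_pos _).le
    _ = _ := by rw [div_eq_mul_inv]; ring

/-! ### The two identities and the bounds for the indicator function -/

/-- The identity behind the lower bound: test the equation of `w` with `w` and `v`, and that of `v`
with `v`. Here `G` is the error in the equation of `w`. -/
theorem inner_sub_eq_lower {A A₀ : E3 → Matrix (Fin 3) (Fin 3) ℝ} {B : ℝ}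
    (hA : IsBoundedCoeff A B) (hs : ∀ᵐ x, (A x).IsSymm) {f : L2} {τ : ℝ} {w v : H1} {G : H1 → ℝ}
    (hw : ∀ φ, energyForm A w φ + τ ^ 2 * inner ℝ (toL2 w) (toL2 φ) = inner ℝ f (toL2 φ) - G φ)
    (hv : ∀ φ, energyForm A₀ v φ + τ ^ 2 * inner ℝ (toL2 v) (toL2 φ) = inner ℝ f (toL2 φ)) :
    inner ℝ f (toL2 w - toL2 v) = energyForm A₀ v v - energyForm A v v
      + (energyForm A (w - v) (w - v) + τ ^ 2 * ‖toL2 w - toL2 v‖ ^ 2) + (G w - 2 * G v) := by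
  have h1 := hw w
  have h2 := hw v
  have h3 := hv v
  rw [← real_inner_self_eq_norm_sq, energyForm_sub_sub hA hs]
  simp only [inner_sub_left, inner_sub_right]
  rw [real_inner_comm (toL2 w) (toL2 v)]
  linear_combination -h1 + 2 * h2 - h3

/-- The identity behind the upper bound: test the equation of `w` with `w`, and that of `v` with `w`
and `v`. -/
theorem inner_sub_eq_upper {A A₀ : E3 → Matrix (Fin 3) (Fin 3) ℝ} {B : ℝ}
    (hA₀ : IsBoundedCoeff A₀ B) (hs : ∀ᵐ x, (A₀ x).IsSymm) {f : L2} {τ : ℝ} {w v : H1}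
    {G : H1 → ℝ}
    (hw : ∀ φ, energyForm A w φ + τ ^ 2 * inner ℝ (toL2 w) (toL2 φ) = inner ℝ f (toL2 φ) - G φ)
    (hv : ∀ φ, energyForm A₀ v φ + τ ^ 2 * inner ℝ (toL2 v) (toL2 φ) = inner ℝ f (toL2 φ)) :
    inner ℝ f (toL2 w - toL2 v) = energyForm A₀ w w - energyForm A w w
      - (energyForm A₀ (w - v) (w - v) + τ ^ 2 * ‖toL2 w - toL2 v‖ ^ 2) - G w := by
  have h1 := hw w
  have h2 := hv w
  have h3 := hv v
  have hc : energyForm A₀ w v = energyForm A₀ v w := by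
    rw [hA₀.energyForm_eq, hA₀.energyForm_eq, hA₀.inner_op_comm hs]
  rw [← real_inner_self_eq_norm_sq, energyForm_sub_sub hA₀ hs, hc]
  simp only [inner_sub_left, inner_sub_right]
  rw [real_inner_comm (toL2 v) (toL2 w)]
  linear_combination h1 - 2 * h2 + h3

/-- Completing the square: with `z = A⁻¹ A₀ ∇v`, the difference of the two sides is
`∫ A(∇w - z) · (∇w - z) dx ≥ 0`. -/
theorem energyForm_sub_le_of_op_eq {A A₀ : E3 → Matrix (Fin 3) (Fin 3) ℝ} {B B₀ c : ℝ}
    (hA : IsBoundedCoeff A B) (hs : ∀ᵐ x, (A x).IsSymm) (c0 : 0 ≤ c)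
    (hc : ∀ᵐ x, ∀ ξ : E3, c * ‖ξ‖ ^ 2 ≤ (A x *ᵥ ξ.ofLp) ⬝ᵥ ξ.ofLp)
    (hA₀ : IsBoundedCoeff A₀ B₀) (hs₀ : ∀ᵐ x, (A₀ x).IsSymm) {w v : H1} {z : L2Vec}
    (hz : hA.op z = hA₀.op (weakGrad v)) :
    energyForm A₀ w w - energyForm A w w - energyForm A₀ (w - v) (w - v)
      ≤ inner ℝ (hA₀.op (weakGrad v)) z - inner ℝ (hA₀.op (weakGrad v)) (weakGrad v) := by
  have h1 : 0 ≤ inner ℝ (hA.op (weakGrad w - z)) (weakGrad w - z) :=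
    le_trans (by positivity) (hA.coercive_op hc _)
  rw [energyForm_sub_sub hA₀ hs₀]
  simp only [map_sub, inner_sub_left, inner_sub_right] at h1
  rw [hA.inner_op_comm hs (weakGrad w) z, hz] at h1
  simp only [hA.energyForm_eq, hA₀.energyForm_eq]
  rw [hA₀.inner_op_comm hs₀ (weakGrad w) (weakGrad v)]
  linarith

theorem integral_invSqrt_eq {γp γm : ℝ} {A : E3 → Matrix (Fin 3) (Fin 3) ℝ} {B : ℝ}
    (hA : IsBoundedCoeff A B) (hpos : ∀ᵐ x, (A x).PosDef) {k z : L2Vec}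
    (hz : hA.op z = (isBoundedCoeff_background γp γm).op k) :
    ∫ x, background γp γm x *
        (((background γp γm x • (1 : Matrix (Fin 3) (Fin 3) ℝ) - A x) *ᵥ
          (invSqrt (A x) *ᵥ (k x).ofLp)) ⬝ᵥ (invSqrt (A x) *ᵥ (k x).ofLp))
      = inner ℝ ((isBoundedCoeff_background γp γm).op k) z
        - inner ℝ ((isBoundedCoeff_background γp γm).op k) k := by
  set h0 := isBoundedCoeff_background γp γm
  rw [h0.inner_op, h0.inner_op, ← integral_sub (h0.integrable_form k z) (h0.integrable_form k k)]
  refine integral_congr_ae ?_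
  have h1 := hA.coeFn_op z
  rw [hz] at h1
  filter_upwards [hpos, h1, h0.coeFn_op k] with x hx h1 h2
  have h3 : A x *ᵥ (z x).ofLp = background γp γm x • (k x).ofLp := by
    have := congrArg WithLp.ofLp (h1.symm.trans h2)
    simpa [Matrix.smul_mulVec] using this
  rw [invSqrt_form hx _ h3]
  simp [Matrix.smul_mulVec]

theorem integral_contrast_eq {γp γm : ℝ} {A : E3 → Matrix (Fin 3) (Fin 3) ℝ} {B : ℝ}
    (hA : IsBoundedCoeff A B) (v : H1) :
    ∫ x, ((background γp γm x • (1 : Matrix (Fin 3) (Fin 3) ℝ) - A x) *ᵥ (weakGrad v x).ofLp) ⬝ᵥ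
        (weakGrad v x).ofLp
      = energyForm (fun x => background γp γm x • (1 : Matrix (Fin 3) (Fin 3) ℝ)) v v
        - energyForm A v v := by
  rw [energyForm, energyForm, ← integral_sub
    ((isBoundedCoeff_background γp γm).integrable_form _ _) (hA.integrable_form _ _)]
  simp only [Matrix.sub_mulVec, sub_dotProduct]

theorem indicatorFunction_eq (T τ : ℝ) (f : L2) (u : ℝ → H1) (v : H1) :
    indicatorFunction T τ f u v = inner ℝ f (truncatedLaplace T τ u - toL2 v) := by
  rw [indicatorFunction, inner_L2_eq]
  refine integral_congr_ae ?_
  filter_upwards [Lp.coeFn_sub (truncatedLaplace T τ u) (toL2 v)] with x hx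
  rw [hx, Pi.sub_apply]

end LayeredWave

theorem lemma1p1
    (γp γm : ℝ) (hγp : 0 < γp) (hγm : 0 < γm)
    (D : Set LayeredWave.E3) (hDopen : IsOpen D) (hDbdd : Bornology.IsBounded D)
    (hDlower : closure D ⊆ {x | x 2 < 0}) (hDC2 : LayeredWave.HasC2Boundary D)
    (h : LayeredWave.E3 → Matrix (Fin 3) (Fin 3) ℝ)
    (h_bdd : ∀ i j, MemLp (fun x => h x i j) ∞ (volume.restrict D))
    (h_symm : ∀ᵐ x ∂(volume.restrict D), (h x).IsSymm)
    (h_pos : ∃ C : ℝ, 0 < C ∧ ∀ᵐ x ∂(volume.restrict D), ∀ ξ : LayeredWave.E3,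
      C * ‖ξ‖ ^ 2 ≤ (LayeredWave.conductivity γp γm D h x *ᵥ ξ.ofLp) ⬝ᵥ ξ.ofLp)
    (T : ℝ) (hT : 0 < T) (f : LayeredWave.L2)
    (u : ℝ → LayeredWave.H1)
    (hu : LayeredWave.IsWeakWaveSolution (LayeredWave.conductivity γp γm D h) T f u)
    (v : ℝ → LayeredWave.H1)
    (hv : ∀ τ : ℝ, 0 < τ →
      LayeredWave.IsWeakEllipticSolution (LayeredWave.background γp γm) τ f (v τ)) :
    (∃ r : ℝ → ℝ, r =O[atTop] (fun τ : ℝ => τ⁻¹ * Real.exp (-τ * T)) ∧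
      ∀ τ : ℝ, 0 < τ →
        (∫ x, ((LayeredWave.background γp γm x • (1 : Matrix (Fin 3) (Fin 3) ℝ)
              - LayeredWave.conductivity γp γm D h x) *ᵥ (LayeredWave.weakGrad (v τ) x).ofLp)
            ⬝ᵥ (LayeredWave.weakGrad (v τ) x).ofLp) + r τ
          ≤ LayeredWave.indicatorFunction T τ f u (v τ)) ∧
    (∃ r : ℝ → ℝ, r =O[atTop] (fun τ : ℝ => τ⁻¹ * Real.exp (-τ * T)) ∧
      ∀ τ : ℝ, 0 < τ →
        LayeredWave.indicatorFunction T τ f u (v τ) ≤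
          (∫ x, LayeredWave.background γp γm x *
            (((LayeredWave.background γp γm x • (1 : Matrix (Fin 3) (Fin 3) ℝ)
                - LayeredWave.conductivity γp γm D h x) *ᵥ
              (LayeredWave.invSqrt (LayeredWave.conductivity γp γm D h x) *ᵥ
                (LayeredWave.weakGrad (v τ) x).ofLp))
              ⬝ᵥ (LayeredWave.invSqrt (LayeredWave.conductivity γp γm D h x) *ᵥ
                (LayeredWave.weakGrad (v τ) x).ofLp))) + r τ) := by
  have hDm : MeasurableSet D := hDopen.measurableSet
  obtain ⟨B, hA⟩ := LayeredWave.exists_isBoundedCoeff_conductivity (γp := γp) (γm := γm) hDm h_bdd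
  have hs := LayeredWave.ae_isSymm_conductivity (γp := γp) (γm := γm) hDm h_symm
  obtain ⟨c₁, hc₁, hc₁A⟩ := LayeredWave.exists_coercive_conductivity hγp hγm hDm h_pos
  have hA₀ := LayeredWave.isBoundedCoeff_background γp γm
  have hs₀ : ∀ᵐ x, (LayeredWave.background γp γm x • (1 : Matrix (Fin 3) (Fin 3) ℝ)).IsSymm :=
    ae_of_all _ fun x => Matrix.isSymm_one.smul _
  -- a common ellipticity constant, normalized to be at most `1`
  obtain ⟨c, hc, hc1, hcA, hcA₀⟩ : ∃ c : ℝ, 0 < c ∧ c ≤ 1 ∧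
      (∀ᵐ x, ∀ ξ : LayeredWave.E3, c * ‖ξ‖ ^ 2 ≤
        (LayeredWave.conductivity γp γm D h x *ᵥ ξ.ofLp) ⬝ᵥ ξ.ofLp) ∧
      (∀ᵐ x, ∀ ξ : LayeredWave.E3, c * ‖ξ‖ ^ 2 ≤
        ((LayeredWave.background γp γm x • (1 : Matrix (Fin 3) (Fin 3) ℝ)) *ᵥ ξ.ofLp)
          ⬝ᵥ ξ.ofLp) := by
    refine ⟨min (min c₁ (min γp γm)) 1, by positivity, min_le_right _ _, ?_, ?_⟩
    · filter_upwards [hc₁A] with x hx ξ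
      exact (mul_le_mul_of_nonneg_right ((min_le_left _ _).trans (min_le_left _ _))
        (sq_nonneg _)).trans (hx ξ)
    · refine ae_of_all _ fun x ξ => ?_
      exact (mul_le_mul_of_nonneg_right ((min_le_left _ _).trans (min_le_right _ _))
        (sq_nonneg _)).trans (LayeredWave.coercive_background γp γm x ξ)
  have hpos : ∀ᵐ x, (LayeredWave.conductivity γp γm D h x).PosDef := by
    filter_upwards [hs, hcA] with x hx hx' using LayeredWave.posDef_of_coercive hx hc hx'
  obtain ⟨U, P, hUP⟩ := LayeredWave.exists_truncatedLaplace_eq hA hs hT hu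
  choose w hwu hw using hUP
  obtain ⟨K, hK0, hK⟩ := LayeredWave.exists_abs_residual_le hA f U P
  have hv' : ∀ τ : ℝ, 0 < τ → ∀ φ, LayeredWave.energyForm
      (fun x => LayeredWave.background γp γm x • (1 : Matrix (Fin 3) (Fin 3) ℝ)) (v τ) φ
      + τ ^ 2 * inner ℝ (LayeredWave.toL2 (v τ)) (LayeredWave.toL2 φ)
      = inner ℝ f (LayeredWave.toL2 φ) := by
    intro τ hτ φ
    rw [LayeredWave.inner_L2_eq, LayeredWave.inner_L2_eq]
    exact hv τ hτ φ
  set F := LayeredWave.residual (LayeredWave.conductivity γp γm D h) f U P with hF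
  have hb : 0 ≤ 1 / T * K := by positivity
  -- both solutions have energy norm of order `1 / τ`
  have hFw : ∀ τ, 1 ≤ τ → |F τ (w τ)| ≤ K * (2 * (‖f‖ + 1 / T * K) / c) / τ := by
    intro τ hτ
    have hτ0 : 0 < τ := by linarith
    refine (hK τ hτ (w τ)).trans ?_
    rw [mul_div_assoc]
    refine mul_le_mul_of_nonneg_left ?_ hK0
    refine LayeredWave.norm_add_le_of_energy_le hA hc hc1 hcA hb hτ0 ?_
    rw [hw]
    have h1 := mul_le_mul (LayeredWave.exp_neg_le_div hτ0 hT) (hK τ hτ (w τ)) (abs_nonneg _)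
      (by positivity)
    have h2 := mul_le_mul_of_nonneg_left (neg_abs_le (F τ (w τ))) (Real.exp_pos (-τ * T)).le
    have h3 : 1 / T / τ * (K * (‖LayeredWave.weakGrad (w τ)‖ + τ * ‖LayeredWave.toL2 (w τ)‖))
      = 1 / T * K / τ * (‖LayeredWave.weakGrad (w τ)‖ + τ * ‖LayeredWave.toL2 (w τ)‖) := by ring
    linarith
  have hFv : ∀ τ, 1 ≤ τ → |F τ (v τ)| ≤ K * (2 * (‖f‖ + 0) / c) / τ := by
    intro τ hτ
    have hτ0 : 0 < τ := by linarith
    refine (hK τ hτ (v τ)).trans ?_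
    rw [mul_div_assoc]
    refine mul_le_mul_of_nonneg_left ?_ hK0
    refine LayeredWave.norm_add_le_of_energy_le hA₀ hc hc1 hcA₀ le_rfl hτ0 ?_
    rw [hv' τ hτ0]
    simp
  constructor
  · refine ⟨fun τ => Real.exp (-τ * T) * (F τ (w τ) - 2 * F τ (v τ)),
      LayeredWave.isBigO_exp_mul (L := K * (2 * (‖f‖ + 1 / T * K) / c)
        + 2 * (K * (2 * (‖f‖ + 0) / c))) fun τ hτ => ?_, fun τ hτ => ?_⟩
    · refine (abs_sub _ _).trans ?_
      rw [abs_mul, abs_two, add_div, mul_div_assoc 2 (K * _)]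
      linarith [hFw τ hτ, hFv τ hτ]
    · rw [LayeredWave.integral_contrast_eq hA, LayeredWave.indicatorFunction_eq, ← hwu τ,
        LayeredWave.inner_sub_eq_lower (G := fun φ => Real.exp (-τ * T) * F τ φ) hA hs
          (hw τ) (hv' τ hτ)]
      have h1 : 0 ≤ LayeredWave.energyForm (LayeredWave.conductivity γp γm D h)
          (w τ - v τ) (w τ - v τ) :=
        le_trans (by positivity) (LayeredWave.coercive_energyForm hA hcA _)
      have h2 : 0 ≤ τ ^ 2 * ‖LayeredWave.toL2 (w τ) - LayeredWave.toL2 (v τ)‖ ^ 2 := by positivity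
      linarith
  · refine ⟨fun τ => Real.exp (-τ * T) * -F τ (w τ),
      LayeredWave.isBigO_exp_mul (L := K * (2 * (‖f‖ + 1 / T * K) / c)) fun τ hτ => ?_,
      fun τ hτ => ?_⟩
    · rw [abs_neg]
      exact hFw τ hτ
    · obtain ⟨z, hz⟩ := hA.exists_op_eq hc hcA (hA₀.op (LayeredWave.weakGrad (v τ)))
      rw [LayeredWave.integral_invSqrt_eq hA hpos hz, LayeredWave.indicatorFunction_eq, ← hwu τ,
        LayeredWave.inner_sub_eq_upper (G := fun φ => Real.exp (-τ * T) * F τ φ) hA₀ hs₀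
          (hw τ) (hv' τ hτ)]
      have h1 := LayeredWave.energyForm_sub_le_of_op_eq hA hs hc.le hcA hA₀ hs₀ (w := w τ) hz
      have h2 : 0 ≤ τ ^ 2 * ‖LayeredWave.toL2 (w τ) - LayeredWave.toL2 (v τ)‖ ^ 2 := by positivity
      linarith
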